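/- Let $C_1$ and $C_2$ be smooth conics in $\mathbb{CP}^3$ spanning distinct planes $\Pi_1\neq\Pi_2$. A \emph{stationary bisecant} of $C_1$ and $C_2$ is a line spanned by points $p\in C_1$ and $q\in C_2$ with $p\neq q$ whose tangent lines $T_pC_1$ and $T_qC_2$ meet. The \emph{edge surface} $\mathcal{E}$ of $C_1$ and $C_2$ is the Zariski closure in $\mathbb{CP}^3$ of the union of all stationary bisecants. \textbf{Theorem.} If $C_1\cap C_2=\emptyset$ and neither conic is tangent to the plane of the other (that is, no tangent line $T_pC_1$, $p\in C_1$, lies in $\Pi_2$, and no tangent line $T_qC_2$, $q\in C_2$, lies in $\Pi_1$), then $\mathcal{E}$ is a surface of degree eight in $\mathbb{CP}^3$, i.e. its homogeneous ideal is generated by a homogeneous polynomial of degree eight. -/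

import Mathlib

noncomputable section

namespace EdgeSurface

/-- Homogeneous coordinate vectors of complex projective three-space. -/
abbrev Vec : Type := Fin 4 → ℂ

/-- Complex projective three-space `ℂℙ³`. Its linear subspaces are written as linear subspaces of
`Vec`: a plane is a subspace of dimension three, a line is a subspace of dimension two, and the
point `x` lies on the linear subspace `L` when `x.submodule ≤ L`. -/
abbrev P3 : Type := Projectivization ℂ Vec

/-- A smooth conic in `ℂℙ³`: a plane together with a quadric whose restriction to that plane
is a nondegenerate quadratic form. -/
structure SmoothConic where
  /-- The plane spanned by the conic. -/
  plane : Submodule ℂ Vec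
  /-- A quadratic form that cuts out the conic in its plane. -/
  form : QuadraticForm ℂ Vec
  finrank_plane : Module.finrank ℂ plane = 3
  nondegenerate : ∀ u ∈ plane, (∀ v ∈ plane, QuadraticMap.polar form u v = 0) → u = 0

namespace SmoothConic

/-- The points of the conic: the points of its plane at which the form vanishes. -/
def points (C : SmoothConic) : Set P3 :=
  {p | p.submodule ≤ C.plane ∧ C.form p.rep = 0}

/-- The tangent line `T_p C` at a point `p` of the conic. The linear form `polar form p` is the
differential of the quadratic form at `p`, so this is the set of vectors of the plane of `C` that
are annihilated by the differential at `p` of the equation of `C`. -/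
def tangentLine (C : SmoothConic) (p : P3) : Submodule ℂ Vec :=
  C.plane ⊓ LinearMap.ker (C.form.polarBilin p.rep)

/-- The conic is tangent to the plane `W`: one of its tangent lines lies in `W`. -/
def IsTangentTo (C : SmoothConic) (W : Submodule ℂ Vec) : Prop :=
  ∃ p ∈ C.points, C.tangentLine p ≤ W

end SmoothConic

/-- The line `L` is a stationary bisecant of `C₁` and `C₂`: it is spanned by points `p` of `C₁` and
`q` of `C₂` with `p ≠ q` such that the tangent lines `T_p C₁` and `T_q C₂` meet. -/
def IsStationaryBisecant (C₁ C₂ : SmoothConic) (L : Submodule ℂ Vec) : Prop :=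
  ∃ p ∈ C₁.points, ∃ q ∈ C₂.points, p ≠ q ∧
    (∃ r : P3, r.submodule ≤ C₁.tangentLine p ∧ r.submodule ≤ C₂.tangentLine q) ∧
    L = p.submodule ⊔ q.submodule

/-- The coordinate vectors of the points of a subset of `ℂℙ³`. -/
def coneOver (S : Set P3) : Set Vec :=
  {v | ∃ hv : v ≠ 0, Projectivization.mk ℂ v hv ∈ S}

/-- The ideal of a subset of `ℂℙ³`, in the homogeneous coordinate ring `ℂ[x₀, x₁, x₂, x₃]`:
the polynomials that vanish at all coordinate vectors of all points of the subset. -/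
def idealOf (S : Set P3) : Ideal (MvPolynomial (Fin 4) ℂ) :=
  MvPolynomial.vanishingIdeal ℂ (coneOver S)

/-- The Zariski closure in `ℂℙ³`: the points at which all homogeneous polynomials
that vanish on the given set vanish. -/
def zariskiClosure (S : Set P3) : Set P3 :=
  {x | ∀ (n : ℕ) (F : MvPolynomial (Fin 4) ℂ), F.IsHomogeneous n →
    (∀ y ∈ S, MvPolynomial.eval y.rep F = 0) → MvPolynomial.eval x.rep F = 0}

/-- The subset `S` of `ℂℙ³` is an algebraic surface of degree `d`: it is Zariski closed, and its
ideal is generated by a nonzero homogeneous polynomial of degree `d`. -/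
def IsSurfaceOfDegree (S : Set P3) (d : ℕ) : Prop :=
  zariskiClosure S = S ∧ ∃ F : MvPolynomial (Fin 4) ℂ,
    F ≠ 0 ∧ F.IsHomogeneous d ∧ idealOf S = Ideal.span {F}

/-- The edge surface of two conics: the Zariski closure of the union of their
stationary bisecants. -/
def edgeSurface (C₁ C₂ : SmoothConic) : Set P3 :=
  zariskiClosure {x | ∃ L : Submodule ℂ Vec, IsStationaryBisecant C₁ C₂ L ∧ x.submodule ≤ L}

end EdgeSurface

end

/-! ### The discriminant of a cubic and its fibres of eight points. -/

namespace EdgeSurface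

/-! If the tangents at `p` and `q` meet, they meet on the common line of the two planes. The
hypotheses make both conics restrict to nondegenerate binary forms on that line without a common
zero. These forms diagonalise simultaneously, and adding the pole of the line for each conic gives
coordinates in which everything is diagonal (`exists_normal_form`), with parameters `α ≠ β`, both
nonzero.

There, stationarity reads `q = (w, ρs, ρt, 0)` for `p = (0, αs, βt, z)`. The cubic in `τ` is
`τ(α+τ)(β+τ)` times `αX/(α+τ) + βY/(β+τ) + Z + W/τ`, where `X, Y, Z, W` are the squares of the
coordinates `x, y, z, w`. It describes the quadrics whose duals lie in the pencil spanned by the two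
dual conics. At `p + q` it has the double root `ρ`, so the discriminant, of degree eight in the
coordinates, vanishes on all stationary bisecants.

Conversely, the discriminant has degree eight in `w` with leading coefficient `(α - β)^2`, and over
general `(x, y, z)` there are eight distinct values of `w` that give points of bisecants
(`exists_eight_param`). A polynomial vanishing on the bisecants therefore has remainder zero on
division by the discriminant (`edgePoly_dvd`). This yields the whole ideal at once, with no separate
proof of irreducibility or reducedness. -/

/-- The discriminant of the cubic `(α + τ)(β + τ)(Zτ + W) + αXτ(β + τ) + βYτ(α + τ)` in `τ`. -/
def edgeDisc {R : Type*} [CommRing R] (α β X Y Z W : R) : R :=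
  Cubic.discr ⟨Z, W + (α + β) * Z + α * X + β * Y, (α + β) * W + α * β * (Z + X + Y), α * β * W⟩

theorem map_edgeDisc {R S : Type*} [CommRing R] [CommRing S] (f : R →+* S) (α β X Y Z W : R) :
    f (edgeDisc α β X Y Z W) = edgeDisc (f α) (f β) (f X) (f Y) (f Z) (f W) := by
  simp only [edgeDisc, Cubic.discr, map_add, map_sub, map_mul, map_pow, map_ofNat]

/-- The cubic factors as `-(uτ - m)^2 * ((α^2 s^2 + β^2 t^2)τ + αβ(αs^2 + βt^2))`, so it has a
repeated factor. -/
theorem edgeDisc_eq_zero_of_param {R : Type*} [CommRing R] (α β s t u m : R) :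
    edgeDisc α β ((s * (α * u + m)) ^ 2) ((t * (β * u + m)) ^ 2)
      (-(u ^ 2 * (α ^ 2 * s ^ 2 + β ^ 2 * t ^ 2))) (-(m ^ 2 * (α * s ^ 2 + β * t ^ 2))) = 0 := by
  simp only [edgeDisc, Cubic.discr]
  ring

/-- As a polynomial in `W`, the discriminant has degree four with leading coefficient
`(α - β) ^ 2`. -/
theorem exists_edgeDisc_expansion {R : Type*} [CommRing R] (α β X Y Z : R) :
    ∃ e₀ e₁ e₂ e₃ : R, ∀ {S : Type _} [CommRing S] (f : R →+* S) (W : S),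
      edgeDisc (f α) (f β) (f X) (f Y) (f Z) W =
        f ((α - β) ^ 2) * W ^ 4 + f e₃ * W ^ 3 + f e₂ * W ^ 2 + f e₁ * W + f e₀ := by
  -- The lower coefficients of the cubic are `W + b`, `pW + c` and `qW`.
  let b := (α + β) * Z + α * X + β * Y
  let c := α * β * (Z + X + Y)
  let p := α + β
  let q := α * β
  refine ⟨b ^ 2 * c ^ 2 - 4 * Z * c ^ 3,
    2 * b * c ^ 2 + 2 * b ^ 2 * c * p - 12 * Z * c ^ 2 * p - 4 * b ^ 3 * q + 18 * Z * b * c * q,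
    c ^ 2 + 4 * b * c * p + b ^ 2 * p ^ 2 - 12 * Z * c * p ^ 2 - 12 * b ^ 2 * q - 27 * Z ^ 2 * q ^ 2
      + 18 * Z * q * (c + b * p),
    2 * c * p + 2 * b * p ^ 2 - 4 * Z * p ^ 3 - 12 * b * q + 18 * Z * p * q, fun f W => ?_⟩
  simp only [edgeDisc, Cubic.discr, b, c, p, q, map_add, map_sub, map_mul, map_pow, map_ofNat]
  ring

open Polynomial in
/-- For general `x, y, z` the line over `(x, y, z)` contains eight points parametrised as
in `edgeDisc_eq_zero_of_param`. -/
theorem exists_eight_param {α β x y z : ℂ} (hα : α ≠ 0) (hβ : β ≠ 0) (hαβ : α ≠ β)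
    (hx : x ≠ 0) (hy : y ≠ 0) (hz : z ≠ 0) (h₁ : x ^ 2 + y ^ 2 + z ^ 2 ≠ 0)
    (h₂ : ((α + β) * z ^ 2 + α * x ^ 2 + β * y ^ 2) ^ 2
      - 4 * α * β * z ^ 2 * (x ^ 2 + y ^ 2 + z ^ 2) ≠ 0)
    (h₃ : (α ^ 2 * x ^ 2 + β ^ 2 * y ^ 2 + (α - β) ^ 2 * z ^ 2) ^ 3
      - 27 * (α - β) ^ 2 * α ^ 2 * β ^ 2 * x ^ 2 * y ^ 2 * z ^ 2 ≠ 0) :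
    ∃ S : Finset ℂ, S.card = 8 ∧ ∀ w ∈ S, w ≠ 0 ∧ ∃ s t ρ : ℂ, x = s * (α + ρ) ∧
      y = t * (β + ρ) ∧ z ^ 2 = -(α ^ 2 * s ^ 2 + β ^ 2 * t ^ 2) ∧
      w ^ 2 = -(ρ ^ 2 * (α * s ^ 2 + β * t ^ 2)) := by
  classical
  have hc : α - β ≠ 0 := sub_ne_zero.2 hαβ
  have hz2 : z ^ 2 ≠ 0 := pow_ne_zero 2 hz
  -- This is `z^2 = -(α^2 s^2 + β^2 t^2)` with `s = x/(α+ρ)`, `t = y/(β+ρ)` and denominators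
  -- cleared; its roots are the admissible `ρ`.
  let q : ℂ[X] := C (z ^ 2) * (X + C α) ^ 2 * (X + C β) ^ 2 + C (α ^ 2 * x ^ 2) * (X + C β) ^ 2
    + C (β ^ 2 * y ^ 2) * (X + C α) ^ 2
  have hdeg : q.natDegree = 4 := by
    simp only [q]
    compute_degree!
  have hq0 : q ≠ 0 := by
    intro h
    simp [h] at hdeg
  have heval (ρ : ℂ) : q.eval ρ = z ^ 2 * (ρ + α) ^ 2 * (ρ + β) ^ 2
      + α ^ 2 * x ^ 2 * (ρ + β) ^ 2 + β ^ 2 * y ^ 2 * (ρ + α) ^ 2 := by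
    simp [q]
  have hderiv (ρ : ℂ) : q.derivative.eval ρ = 2 * (z ^ 2 * (ρ + α) * (ρ + β) * ((ρ + α) + (ρ + β))
      + α ^ 2 * x ^ 2 * (ρ + β) + β ^ 2 * y ^ 2 * (ρ + α)) := by
    simp [q, derivative_pow]
    ring
  have hroot (ρ : ℂ) (h : q.eval ρ = 0) : α + ρ ≠ 0 ∧ β + ρ ≠ 0 := by
    rw [heval] at h
    constructor
    · intro h0
      obtain rfl : ρ = -α := by linear_combination h0
      refine mul_ne_zero (mul_ne_zero (pow_ne_zero 2 hα) (pow_ne_zero 2 hx)) (pow_ne_zero 2 hc) ?_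
      linear_combination h
    · intro h0
      obtain rfl : ρ = -β := by linear_combination h0
      refine mul_ne_zero (mul_ne_zero (pow_ne_zero 2 hβ) (pow_ne_zero 2 hy)) (pow_ne_zero 2 hc) ?_
      linear_combination h
  have hsep : q.Separable := by
    rw [separable_def]
    refine isCoprime_of_dvd _ _ (fun h => hq0 h.1) fun p hp _ hpq hpd => ?_
    obtain ⟨ρ, hρ⟩ := IsAlgClosed.exists_root p
      (fun h => hp (isUnit_iff_degree_eq_zero.2 h))
    have e1 : q.eval ρ = 0 := (hρ.dvd hpq)
    have e2 : q.derivative.eval ρ = 0 := (hρ.dvd hpd)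
    obtain ⟨hu, hv⟩ := hroot ρ e1
    rw [heval] at e1
    rw [hderiv] at e2
    set u := α + ρ with hudef
    set v := β + ρ with hvdef
    have huv : α - β = u - v := by rw [hudef, hvdef]; ring
    rw [add_comm ρ α, add_comm ρ β, ← hudef, ← hvdef] at e1 e2
    have e3 : z ^ 2 * u * v * (u + v) + α ^ 2 * x ^ 2 * v + β ^ 2 * y ^ 2 * u = 0 := by
      linear_combination e2 / 2
    -- At a double root, `q = 0` and `q' = 0` can be solved for `x^2` and `y^2`. Eliminating `u` and
    -- `v` from the two solutions contradicts `h₃`.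
    have e4 : z ^ 2 * u ^ 3 = -(u - v) * α ^ 2 * x ^ 2 := by
      apply mul_left_cancel₀ (pow_ne_zero 2 hv)
      linear_combination u * e1 + u * v * e3 - (u + v) * e1
    have e5 : z ^ 2 * v ^ 3 = (u - v) * β ^ 2 * y ^ 2 := by
      apply mul_left_cancel₀ (pow_ne_zero 2 hu)
      linear_combination v * e1 + u * v * e3 - (u + v) * e1
    have hc' : u - v ≠ 0 := huv ▸ hc
    have e6 : α ^ 2 * x ^ 2 + β ^ 2 * y ^ 2 + (u - v) ^ 2 * z ^ 2 = -3 * z ^ 2 * u * v := by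
      apply mul_left_cancel₀ hc'
      linear_combination e4 - e5
    apply h₃
    rw [huv, e6]
    have e7 : z ^ 2 * u ^ 3 * (z ^ 2 * v ^ 3)
      = -(u - v) * α ^ 2 * x ^ 2 * ((u - v) * β ^ 2 * y ^ 2) := by rw [e4, e5]
    linear_combination -27 * z ^ 2 * e7
  let T := q.roots.toFinset
  have hT : T.card = 4 := by
    rw [Multiset.toFinset_card_of_nodup (nodup_roots hsep), IsAlgClosed.card_roots_eq_natDegree,
      hdeg]
  have hTroot {ρ : ℂ} (h : ρ ∈ T) : q.eval ρ = 0 := by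
    simpa [T, hq0] using h
  let V (ρ : ℂ) : ℂ := -(ρ ^ 2 * (α * (x / (α + ρ)) ^ 2 + β * (y / (β + ρ)) ^ 2))
  have hzroot {ρ : ℂ} (h : ρ ∈ T) :
      z ^ 2 = -(α ^ 2 * (x / (α + ρ)) ^ 2 + β ^ 2 * (y / (β + ρ)) ^ 2) := by
    obtain ⟨hu, hv⟩ := hroot ρ (hTroot h)
    have := hTroot h
    rw [heval] at this
    field_simp
    linear_combination this
  have hcubic {ρ : ℂ} (h : ρ ∈ T) : ∃ d : ℂ, ∀ τ : ℂ,
      (α + τ) * (β + τ) * (z ^ 2 * τ + V ρ) + α * x ^ 2 * τ * (β + τ) + β * y ^ 2 * τ * (α + τ)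
        = (τ - ρ) ^ 2 * (z ^ 2 * τ + d) := by
    obtain ⟨hu, hv⟩ := hroot ρ (hTroot h)
    have hxs : x = x / (α + ρ) * (α + ρ) := by field_simp
    have hyt : y = y / (β + ρ) * (β + ρ) := by field_simp
    -- The value of `d` comes from comparing constant terms.
    refine ⟨-(α * β * (α * (x / (α + ρ)) ^ 2 + β * (y / (β + ρ)) ^ 2)), fun τ => ?_⟩
    simp only [V]
    rw [hzroot h]
    generalize x / (α + ρ) = s at *
    generalize y / (β + ρ) = t at *
    subst hxs hyt
    ring
  -- If `V ρ = 0`, the cubic is `τ` times a quadratic. Since `h₁` excludes `ρ = 0`, the double root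
  -- belongs to the quadratic, whose discriminant is nonzero by `h₂`.
  have hV0 {ρ : ℂ} (h : ρ ∈ T) : V ρ ≠ 0 := by
    intro h0
    obtain ⟨d, hd⟩ := hcubic h
    rw [h0] at hd
    have hρ : ρ ≠ 0 := by
      rintro rfl
      have := hTroot h
      rw [heval] at this
      apply h₁
      apply mul_left_cancel₀ (mul_ne_zero (pow_ne_zero 2 hα) (pow_ne_zero 2 hβ))
      linear_combination this
    have hd0 : d = 0 := by
      have := hd 0
      simpa [hρ] using this
    have hM (τ : ℂ) (hτ : τ ≠ 0) : z ^ 2 * τ ^ 2 + ((α + β) * z ^ 2 + α * x ^ 2 + β * y ^ 2) * τ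
        + α * β * (x ^ 2 + y ^ 2 + z ^ 2) = z ^ 2 * (τ - ρ) ^ 2 := by
      apply mul_left_cancel₀ hτ
      linear_combination hd τ + (τ - ρ) ^ 2 * hd0
    have m1 := hM 1 one_ne_zero
    have m2 := hM (-1) (by norm_num)
    have b1 : (α + β) * z ^ 2 + α * x ^ 2 + β * y ^ 2 = -2 * ρ * z ^ 2 := by
      linear_combination (m1 - m2) / 2
    have b2 : α * β * (x ^ 2 + y ^ 2 + z ^ 2) = z ^ 2 * ρ ^ 2 := by
      linear_combination (m1 + m2) / 2
    apply h₂
    rw [b1]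
    linear_combination -4 * z ^ 2 * b2
  -- Equal values of `V` give the same cubic, which cannot have two distinct double roots.
  have hVinj {ρ σ : ℂ} (hρ : ρ ∈ T) (hσ : σ ∈ T) (h : V ρ = V σ) : ρ = σ := by
    by_contra hne
    have hne' : ρ - σ ≠ 0 := sub_ne_zero.2 hne
    obtain ⟨d, hd⟩ := hcubic hρ
    obtain ⟨d', hd'⟩ := hcubic hσ
    rw [← h] at hd'
    have k (τ : ℂ) : (τ - ρ) ^ 2 * (z ^ 2 * τ + d) = (τ - σ) ^ 2 * (z ^ 2 * τ + d') :=
      (hd τ).symm.trans (hd' τ)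
    have k1 : z ^ 2 * ρ + d' = 0 := by
      have := k ρ
      simpa [hne'] using this
    have k2 : z ^ 2 * σ + d = 0 := by
      have := k σ
      simpa [sub_ne_zero.2 (Ne.symm hne)] using this
    have k3 (τ : ℂ) : (τ - ρ) * (τ - σ) * (ρ - σ) = 0 := by
      apply mul_left_cancel₀ hz2
      linear_combination -k τ + (τ - ρ) ^ 2 * k2 - (τ - σ) ^ 2 * k1
    -- Any `τ` other than `ρ` and `σ` would do; here the product equals `2(ρ - σ)^3`.
    have l1 := k3 (2 * ρ - σ)
    apply mul_ne_zero (mul_ne_zero hne' hne') hne'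
    linear_combination l1 / 2
  choose r hr using fun ρ : ℂ => IsAlgClosed.exists_pow_nat_eq (V ρ) (n := 2) two_pos
  -- Four nonzero, distinct values of `w^2`, each with two square roots.
  refine ⟨(T ×ˢ {1, -1}).image fun p : ℂ × ℂ => p.2 * r p.1, ?_, ?_⟩
  · rw [Finset.card_image_of_injOn, Finset.card_product, hT,
      Finset.card_pair (by norm_num)]
    rintro ⟨ρ, ε⟩ h ⟨σ, δ⟩ h' heq
    simp only [Finset.coe_product, Set.mem_prod, Finset.mem_coe, Finset.mem_insert,
      Finset.mem_singleton] at h h' heq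
    have hε : ε ^ 2 = 1 := by rcases h.2 with h | h <;> simp [h]
    have hδ : δ ^ 2 = 1 := by rcases h'.2 with h | h <;> simp [h]
    obtain rfl : ρ = σ := by
      apply hVinj h.1 h'.1
      rw [← hr, ← hr, ← one_mul (r ρ ^ 2), ← one_mul (r σ ^ 2), ← hε, ← mul_pow, heq, mul_pow, hδ,
        hε]
    have hr0 : r ρ ≠ 0 := by
      intro h0
      apply hV0 h.1
      rw [← hr, h0]
      simp
    rw [mul_right_cancel₀ hr0 heq]
  · intro w hw
    obtain ⟨⟨ρ, ε⟩, h, rfl⟩ := Finset.mem_image.1 hw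
    simp only [Finset.mem_product, Finset.mem_insert, Finset.mem_singleton] at h
    have hε : ε ^ 2 = 1 := by rcases h.2 with h | h <;> simp [h]
    have hw2 : (ε * r ρ) ^ 2 = V ρ := by rw [mul_pow, hε, hr, one_mul]
    obtain ⟨hu, hv⟩ := hroot ρ (hTroot h.1)
    refine ⟨fun h0 => hV0 h.1 ?_, x / (α + ρ), y / (β + ρ), ρ, ?_, ?_, hzroot h.1, hw2⟩
    · rw [← hw2]
      simp only at h0
      rw [h0]
      simp
    · field_simp
    · field_simp

end EdgeSurface

/-! ### Linear algebra: diagonal coordinates for the two conics. -/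

namespace EdgeSurface

open QuadraticMap

/-- The line in which two distinct planes of `ℂℙ³` meet. -/
theorem finrank_inf_eq_two {U W : Submodule ℂ Vec} (hU : Module.finrank ℂ U = 3)
    (hW : Module.finrank ℂ W = 3) (hne : U ≠ W) :
    Module.finrank ℂ (U ⊓ W : Submodule ℂ Vec) = 2 := by
  have h := Submodule.finrank_sup_add_finrank_inf_eq U W
  have h4 : Module.finrank ℂ Vec = 4 := by simp
  have hle : Module.finrank ℂ (U ⊔ W : Submodule ℂ Vec) ≤ 4 :=
    (Submodule.finrank_le _).trans h4.le
  have hgt : 3 < Module.finrank ℂ (U ⊔ W : Submodule ℂ Vec) := by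
    by_contra hcon
    have h1 : U = U ⊔ W := Submodule.eq_of_le_of_finrank_le le_sup_left (by omega)
    have h2 : W = U ⊔ W := Submodule.eq_of_le_of_finrank_le le_sup_right (by omega)
    exact hne (h1.trans h2.symm)
  omega

theorem exists_ne_zero_mem_of_lt_finrank {m : ℕ} {W : Submodule ℂ Vec}
    (h : m < Module.finrank ℂ W) (f : Vec →ₗ[ℂ] (Fin m → ℂ)) : ∃ v ∈ W, v ≠ 0 ∧ f v = 0 := by
  have hker : LinearMap.ker (f.domRestrict W) ≠ ⊥ :=
    LinearMap.ker_ne_bot_of_finrank_lt (by simpa using h)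
  obtain ⟨v, hv, hv0⟩ := Submodule.exists_mem_ne_zero_of_ne_bot hker
  exact ⟨v, v.2, by simpa using hv0, by simpa using hv⟩

theorem polar_self_eq (Q : QuadraticForm ℂ Vec) (v : Vec) : polar Q v v = 2 * Q v := by
  rw [QuadraticMap.polar_self, nsmul_eq_mul]
  norm_num

theorem exists_smul_form_eq_one {Q : QuadraticForm ℂ Vec} {v : Vec} (h : Q v ≠ 0) :
    ∃ c : ℂ, c ≠ 0 ∧ Q (c • v) = 1 := by
  obtain ⟨c, hc⟩ := IsAlgClosed.exists_eq_mul_self (Q v)⁻¹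
  refine ⟨c, ?_, ?_⟩
  · rintro rfl
    simp [h] at hc
  · rw [QuadraticMap.map_smul, ← hc, smul_eq_mul, inv_mul_cancel₀ h]

namespace SmoothConic

theorem mk_mem_points {C : SmoothConic} {v : Vec} (hv : v ≠ 0) :
    Projectivization.mk ℂ v hv ∈ C.points ↔ v ∈ C.plane ∧ C.form v = 0 := by
  obtain ⟨a, ha⟩ := Projectivization.exists_smul_eq_mk_rep ℂ v hv
  have ha0 : (a : ℂ) ≠ 0 := a.ne_zero
  simp only [points, Set.mem_ofPred_eq, Projectivization.submodule_mk,
    Submodule.span_singleton_le_iff_mem, ← ha, Units.smul_def, QuadraticMap.map_smul]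
  simp

theorem mem_tangentLine_mk {C : SmoothConic} {u v : Vec} (hv : v ≠ 0) :
    u ∈ C.tangentLine (Projectivization.mk ℂ v hv) ↔ u ∈ C.plane ∧ polar C.form v u = 0 := by
  obtain ⟨a, ha⟩ := Projectivization.exists_smul_eq_mk_rep ℂ v hv
  simp [tangentLine, ← ha, Units.smul_def]

variable {C : SmoothConic} {W : Submodule ℂ Vec}

/-- A conic that is not tangent to a plane restricts to a nondegenerate form on the line of
intersection. -/
theorem nondegenerate_inf (hW : Module.finrank ℂ W = 3) (hne : C.plane ≠ W)
    (ht : ¬ C.IsTangentTo W) {u : Vec} (hu : u ∈ C.plane ⊓ W)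
    (h : ∀ v ∈ C.plane ⊓ W, polar C.form u v = 0) : u = 0 := by
  by_contra hu0
  have hline := finrank_inf_eq_two C.finrank_plane hW hne
  have hQ : C.form u = 0 := by
    have := h u hu
    rw [polar_self_eq] at this
    simpa using this
  -- A vector in the radical is isotropic, and the common line lies in the tangent line at it;
  -- dimensions force equality.
  refine ht ⟨.mk ℂ u hu0, (mk_mem_points hu0).2 ⟨hu.1, hQ⟩, ?_⟩
  set T := C.tangentLine (.mk ℂ u hu0) with hT
  have hle : C.plane ⊓ W ≤ T := fun v hv => (mem_tangentLine_mk hu0).2 ⟨hv.1, h v hv⟩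
  have hTle : T ≤ C.plane := inf_le_left
  have hTlt : T < C.plane := by
    refine lt_of_le_of_ne hTle fun heq => hu0 (C.nondegenerate u hu.1 fun v hv => ?_)
    rw [← heq] at hv
    exact ((mem_tangentLine_mk hu0).1 hv).2
  have hfin := Submodule.finrank_lt_finrank_of_lt hTlt
  rw [C.finrank_plane] at hfin
  rw [← Submodule.eq_of_le_of_finrank_le hle (by omega)]
  exact inf_le_right

/-- The pole, with respect to a conic, of a line that is spanned by orthogonal vectors. -/
theorem exists_pole {a b : Vec} (ha : a ∈ C.plane) (hb : b ∈ C.plane)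
    (hab : polar C.form a b = 0) (hQa : C.form a ≠ 0) (hQb : C.form b ≠ 0) :
    ∃ c ∈ C.plane, C.form c = 1 ∧ polar C.form a c = 0 ∧ polar C.form b c = 0 := by
  have hba : polar C.form b a = 0 := by rw [polar_comm, hab]
  suffices H : ∃ c ∈ C.plane, C.form c ≠ 0 ∧ polar C.form a c = 0 ∧ polar C.form b c = 0 by
    obtain ⟨c, hc, hQc, hac, hbc⟩ := H
    obtain ⟨k, -, hk⟩ := exists_smul_form_eq_one hQc
    exact ⟨k • c, C.plane.smul_mem k hc, hk, by simp [hac], by simp [hbc]⟩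
  obtain ⟨c, hc, hc0, hfc⟩ := exists_ne_zero_mem_of_lt_finrank (W := C.plane) (m := 2)
    (by rw [C.finrank_plane]; norm_num)
    (LinearMap.pi ![C.form.polarBilin a, C.form.polarBilin b])
  have hac : polar C.form a c = 0 := by simpa using congrFun hfc 0
  have hbc : polar C.form b c = 0 := by simpa using congrFun hfc 1
  -- Otherwise the orthogonal complement of `a, b` is totally isotropic, so by polarisation `c` is
  -- orthogonal to it as well as to `a` and `b`, hence to the whole plane.
  by_contra! H
  have hiso : ∀ v ∈ C.plane, polar C.form a v = 0 → polar C.form b v = 0 → C.form v = 0 := by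
    intro v hv hav hbv
    by_contra hQ
    exact H v hv hQ hav hbv
  refine hc0 (C.nondegenerate c hc fun v hv => ?_)
  set k := v - (polar C.form a v / (2 * C.form a)) • a - (polar C.form b v / (2 * C.form b)) • b
    with hk
  have hkmem : k ∈ C.plane := C.plane.sub_mem (C.plane.sub_mem hv (C.plane.smul_mem _ ha))
    (C.plane.smul_mem _ hb)
  have hak : polar C.form a k = 0 := by
    simp only [hk, polar_sub_right, polar_smul_right, hab, polar_self_eq, smul_eq_mul]
    field_simp
    ring
  have hbk : polar C.form b k = 0 := by
    simp only [hk, polar_sub_right, polar_smul_right, hba, polar_self_eq, smul_eq_mul]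
    field_simp
    ring
  have hck : polar C.form c k = 0 := by
    rw [polar, hiso k hkmem hak hbk, hiso c hc hac hbc,
      hiso (c + k) (C.plane.add_mem hc hkmem) (by rw [polar_add_right, hac, hak, add_zero])
        (by rw [polar_add_right, hbc, hbk, add_zero])]
    simp
  have hv' : v = k + (polar C.form a v / (2 * C.form a)) • a
      + (polar C.form b v / (2 * C.form b)) • b := by
    rw [hk]
    abel
  rw [hv', polar_add_right, polar_add_right, polar_smul_right, polar_smul_right, hck,
    polar_comm _ c a, hac, polar_comm _ c b, hbc]
  simp

/-- The pole of a line with respect to a conic does not lie on the line. -/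
theorem pole_notMem {a b c : Vec} (hW : Module.finrank ℂ W = 3) (hne : C.plane ≠ W)
    (ha : a ∈ C.plane ⊓ W) (hb : b ∈ C.plane ⊓ W) (hc : c ∈ C.plane)
    (hab : polar C.form a b = 0) (hQa : C.form a ≠ 0) (hQb : C.form b ≠ 0) (hQc : C.form c ≠ 0)
    (hac : polar C.form a c = 0) (hbc : polar C.form b c = 0) : c ∉ W := by
  intro hcW
  have hba : polar C.form b a = 0 := by rw [polar_comm, hab]
  have hca : polar C.form c a = 0 := by rw [polar_comm, hac]
  have hcb : polar C.form c b = 0 := by rw [polar_comm, hbc]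
  have hli : LinearIndependent ℂ ![a, b, c] := by
    rw [Fintype.linearIndependent_iff]
    intro g hg
    simp only [Fin.sum_univ_three, Matrix.cons_val_zero, Matrix.cons_val_one,
      Matrix.cons_val] at hg
    have ea := congrArg (polar C.form a) hg
    have eb := congrArg (polar C.form b) hg
    have ec := congrArg (polar C.form c) hg
    simp only [polar_add_right, polar_smul_right, polar_self_eq, hab, hac, hba, hbc, hca, hcb,
      smul_eq_mul, mul_zero, add_zero, zero_add, polar_zero_right, mul_eq_zero, hQa, hQb, hQc,
      OfNat.ofNat_ne_zero, or_false] at ea eb ec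
    intro i
    fin_cases i <;> assumption
  have hspan : Submodule.span ℂ (Set.range ![a, b, c]) ≤ C.plane ⊓ W := by
    rw [Submodule.span_le]
    rintro _ ⟨i, rfl⟩
    fin_cases i
    exacts [ha, hb, ⟨hc, hcW⟩]
  have h := Submodule.finrank_mono hspan
  rw [finrank_span_eq_card hli, finrank_inf_eq_two C.finrank_plane hW hne] at h
  simp at h

end SmoothConic

/-- Two nondegenerate quadratic forms on a plane of vectors without common nontrivial zero
are simultaneously diagonalisable. -/
theorem exists_common_orthogonal {ℓ : Submodule ℂ Vec} (hℓ : Module.finrank ℂ ℓ = 2)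
    {Q₁ Q₂ : QuadraticForm ℂ Vec}
    (h₁ : ∀ u ∈ ℓ, (∀ v ∈ ℓ, polar Q₁ u v = 0) → u = 0)
    (h₂ : ∀ u ∈ ℓ, (∀ v ∈ ℓ, polar Q₂ u v = 0) → u = 0)
    (h₁₂ : ∀ u ∈ ℓ, Q₁ u = 0 → Q₂ u = 0 → u = 0) :
    ∃ a ∈ ℓ, ∃ b ∈ ℓ, Q₁ a = 1 ∧ Q₁ b = 1 ∧ polar Q₁ a b = 0 ∧ polar Q₂ a b = 0 ∧
      Q₂ a ≠ 0 ∧ Q₂ b ≠ 0 ∧ Q₂ a ≠ Q₂ b := by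
  let B (Q : QuadraticForm ℂ Vec) : ℓ →ₗ[ℂ] Module.Dual ℂ ℓ := Q.polarBilin.domRestrict₁₂ ℓ ℓ
  have hB (Q : QuadraticForm ℂ Vec) (u v : ℓ) : B Q u v = polar Q u v := rfl
  have hinj : Function.Injective (B Q₁) := by
    rw [← LinearMap.ker_eq_bot, LinearMap.ker_eq_bot']
    intro u hu
    refine Subtype.ext (h₁ u u.2 fun v hv => ?_)
    exact (hB Q₁ u ⟨v, hv⟩).symm.trans (by rw [hu]; rfl)
  let E := (B Q₁).linearEquivOfInjective hinj Subspace.dual_finrank_eq.symm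
  have : Nontrivial ℓ := Module.nontrivial_of_finrank_pos (R := ℂ) (by omega)
  -- An eigenvector of `B₁⁻¹B₂` has the same orthogonal complement condition for `Q₂` as `c` times
  -- that for `Q₁`.
  obtain ⟨c, hc⟩ := Module.End.exists_eigenvalue (E.symm.toLinearMap ∘ₗ B Q₂)
  obtain ⟨a, ha⟩ := hc.exists_hasEigenvector
  have haE : B Q₂ a = c • B Q₁ a := by
    have h := ha.apply_eq_smul
    have h' := congrArg E h
    simpa [E] using h'
  have hac (v : Vec) (hv : v ∈ ℓ) : polar Q₂ a v = c * polar Q₁ a v :=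
    LinearMap.congr_fun haE ⟨v, hv⟩
  have ha0 : (a : Vec) ≠ 0 := by simpa using ha.2
  have hQ₂a' : Q₂ a = c * Q₁ a := by
    have := hac a a.2
    rw [polar_self_eq, polar_self_eq] at this
    linear_combination this / 2
  have hQ₁a : Q₁ a ≠ 0 := fun h => ha0 (h₁₂ a a.2 h (by rw [hQ₂a', h, mul_zero]))
  obtain ⟨b, hb, hb0, hfb⟩ := exists_ne_zero_mem_of_lt_finrank (W := ℓ) (m := 1) (by omega)
    (LinearMap.pi ![Q₁.polarBilin a])
  have hab₁ : polar Q₁ a b = 0 := by simpa using congrFun hfb 0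
  have hab₂ : polar Q₂ a b = 0 := by rw [hac b hb, hab₁, mul_zero]
  have hspan : ∀ v ∈ ℓ, ∃ k m : ℂ, v = k • (a : Vec) + m • b := by
    have hli : LinearIndependent ℂ ![(a : Vec), b] := by
      rw [LinearIndependent.pair_iff]
      intro s t hst
      have h := congrArg (polar Q₁ a) hst
      simp only [polar_add_right, polar_smul_right, polar_self_eq, hab₁, smul_eq_mul, mul_zero,
        add_zero, polar_zero_right, mul_eq_zero, hQ₁a, OfNat.ofNat_ne_zero, or_false] at h
      refine ⟨h, ?_⟩
      rw [h, zero_smul, zero_add] at hst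
      exact (smul_eq_zero.1 hst).resolve_right hb0
    have hle : Submodule.span ℂ (Set.range ![(a : Vec), b]) ≤ ℓ := by
      rw [Submodule.span_le]
      rintro _ ⟨i, rfl⟩
      fin_cases i
      exacts [a.2, hb]
    have heq := Submodule.eq_of_le_of_finrank_le hle (by
      rw [finrank_span_eq_card hli, hℓ, Fintype.card_fin])
    intro v hv
    rw [← heq, Matrix.range_cons, Matrix.range_cons, Matrix.range_empty, Set.union_empty,
      Set.singleton_union, Submodule.mem_span_pair] at hv
    obtain ⟨k, m, h⟩ := hv
    exact ⟨k, m, h.symm⟩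
  have hQb {Q : QuadraticForm ℂ Vec} (hQ : ∀ u ∈ ℓ, (∀ v ∈ ℓ, polar Q u v = 0) → u = 0)
      (hab : polar Q a b = 0) : Q b ≠ 0 := by
    intro h
    refine hb0 (hQ b hb fun v hv => ?_)
    obtain ⟨k, m, rfl⟩ := hspan v hv
    rw [polar_add_right, polar_smul_right, polar_smul_right, polar_comm _ b a, hab, polar_self_eq,
      h]
    simp
  have hQ₂a : Q₂ a ≠ 0 := by
    intro h
    refine ha0 (h₂ a a.2 fun v hv => ?_)
    obtain ⟨k, m, rfl⟩ := hspan v hv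
    rw [polar_add_right, polar_smul_right, polar_smul_right, hab₂, polar_self_eq, h]
    simp
  obtain ⟨k, hk0, hk⟩ := exists_smul_form_eq_one hQ₁a
  obtain ⟨m, hm0, hm⟩ := exists_smul_form_eq_one (hQb h₁ hab₁)
  refine ⟨k • a, ℓ.smul_mem k a.2, m • b, ℓ.smul_mem m hb, hk, hm, by simp [hab₁], by simp [hab₂],
    ?_, ?_, ?_⟩
  · simp [QuadraticMap.map_smul, hk0, hQ₂a]
  · simp [QuadraticMap.map_smul, hm0, hQb h₂ hab₂]
  · intro heq
    -- If the two values of `Q₂` agreed, `a + ib`, with `a, b` normalised, would be a common zero of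
    -- both forms.
    have hnull := h₁₂ (k • a + Complex.I • m • b)
      (ℓ.add_mem (ℓ.smul_mem k a.2) (ℓ.smul_mem _ (ℓ.smul_mem m hb)))
      (by
        rw [QuadraticMap.map_add Q₁, QuadraticMap.map_smul _ Complex.I, hk, hm]
        simp [hab₁])
      (by
        rw [QuadraticMap.map_add Q₂, QuadraticMap.map_smul _ Complex.I, heq]
        simp [hab₂])
    have h := congrArg (polar Q₁ (a : Vec)) hnull
    simp [hab₁, hk0, hQ₁a] at h

/-- Coordinates in which two conics in general position are diagonal: the first conic is
`x² + y² + z² = 0` in the plane `w = 0`, the second is `αx² + βy² + w² = 0` in the plane `z = 0`. -/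
theorem exists_normal_form {C₁ C₂ : SmoothConic} (hplanes : C₁.plane ≠ C₂.plane)
    (hdisjoint : Disjoint C₁.points C₂.points) (htangent₁ : ¬ C₁.IsTangentTo C₂.plane)
    (htangent₂ : ¬ C₂.IsTangentTo C₁.plane) :
    ∃ (e : Vec ≃ₗ[ℂ] Vec) (α β : ℂ), α ≠ 0 ∧ β ≠ 0 ∧ α ≠ β ∧
      (∀ v, e v ∈ C₁.plane ↔ v 0 = 0) ∧ (∀ v, e v ∈ C₂.plane ↔ v 3 = 0) ∧
      (∀ v, v 0 = 0 → C₁.form (e v) = v 1 ^ 2 + v 2 ^ 2 + v 3 ^ 2) ∧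
      (∀ v, v 3 = 0 → C₂.form (e v) = α * v 1 ^ 2 + β * v 2 ^ 2 + v 0 ^ 2) := by
  obtain ⟨a, ha, b, hb, ha₁, hb₁, hab₁, hab₂, ha₂, hb₂, hne⟩ :=
    exists_common_orthogonal (finrank_inf_eq_two C₁.finrank_plane C₂.finrank_plane hplanes)
      (Q₁ := C₁.form) (Q₂ := C₂.form)
      (fun u hu h => SmoothConic.nondegenerate_inf C₂.finrank_plane hplanes htangent₁ hu h)
      (fun u hu h => SmoothConic.nondegenerate_inf C₁.finrank_plane hplanes.symm htangent₂
        (inf_comm C₁.plane C₂.plane ▸ hu) (inf_comm C₁.plane C₂.plane ▸ h))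
      (fun u hu h h' => by
        by_contra hu0
        exact Set.disjoint_left.1 hdisjoint ((SmoothConic.mk_mem_points hu0).2 ⟨hu.1, h⟩)
          ((SmoothConic.mk_mem_points hu0).2 ⟨hu.2, h'⟩))
  have ha₁' : C₁.form a ≠ 0 := by simp [ha₁]
  have hb₁' : C₁.form b ≠ 0 := by simp [hb₁]
  obtain ⟨c, hc, hQc, hac, hbc⟩ := C₁.exists_pole ha.1 hb.1 hab₁ ha₁' hb₁'
  obtain ⟨d, hd, hQd, had, hbd⟩ := C₂.exists_pole ha.2 hb.2 hab₂ ha₂ hb₂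
  have hcW : c ∉ C₂.plane := SmoothConic.pole_notMem C₂.finrank_plane hplanes ha hb hc hab₁
    ha₁' hb₁' (by simp [hQc]) hac hbc
  have hdW : d ∉ C₁.plane := SmoothConic.pole_notMem C₁.finrank_plane hplanes.symm ha.symm
    hb.symm hd hab₂ ha₂ hb₂ (by simp [hQd]) had hbd
  have hmem₁ (g : Vec) : g 0 • d + g 1 • a + g 2 • b + g 3 • c ∈ C₁.plane ↔ g 0 = 0 := by
    rw [add_assoc, add_assoc, Submodule.add_mem_iff_left _ (C₁.plane.add_mem
      (C₁.plane.smul_mem _ ha.1) (C₁.plane.add_mem (C₁.plane.smul_mem _ hb.1)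
      (C₁.plane.smul_mem _ hc)))]
    refine ⟨fun h => ?_, fun h => by simp [h]⟩
    by_contra h0
    exact hdW ((C₁.plane.smul_mem_iff h0).1 h)
  have hmem₂ (g : Vec) : g 0 • d + g 1 • a + g 2 • b + g 3 • c ∈ C₂.plane ↔ g 3 = 0 := by
    rw [Submodule.add_mem_iff_right _ (C₂.plane.add_mem (C₂.plane.add_mem
      (C₂.plane.smul_mem _ hd) (C₂.plane.smul_mem _ ha.2)) (C₂.plane.smul_mem _ hb.2))]
    refine ⟨fun h => ?_, fun h => by simp [h]⟩
    by_contra h0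
    exact hcW ((C₂.plane.smul_mem_iff h0).1 h)
  have hli : LinearIndependent ℂ ![d, a, b, c] := by
    rw [Fintype.linearIndependent_iff]
    intro g hg
    simp only [Fin.sum_univ_four, Matrix.cons_val_zero, Matrix.cons_val_one,
      Matrix.cons_val] at hg
    have h0 : g 0 = 0 := (hmem₁ g).1 (hg ▸ C₁.plane.zero_mem)
    have h3 : g 3 = 0 := (hmem₂ g).1 (hg ▸ C₂.plane.zero_mem)
    rw [h0, h3, zero_smul, zero_smul, zero_add, add_zero] at hg
    have ea := congrArg (polar C₁.form a) hg
    have eb := congrArg (polar C₁.form b) hg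
    rw [polar_add_right, polar_smul_right, polar_smul_right, polar_self_eq, hab₁, ha₁] at ea
    rw [polar_add_right, polar_smul_right, polar_smul_right, polar_self_eq, polar_comm _ b a, hab₁,
      hb₁] at eb
    have h1 : g 1 = 0 := by simpa using ea
    have h2 : g 2 = 0 := by simpa using eb
    intro i
    fin_cases i <;> assumption
  let e := (basisOfLinearIndependentOfCardEqFinrank hli (by simp)).equivFun.symm
  have he (v : Vec) : e v = v 0 • d + v 1 • a + v 2 • b + v 3 • c := by
    simp [e, Module.Basis.equivFun_symm_apply, Fin.sum_univ_four]
  refine ⟨e, C₂.form a, C₂.form b, ha₂, hb₂, hne, fun v => by rw [he, hmem₁],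
    fun v => by rw [he, hmem₂], fun v hv => ?_, fun v hv => ?_⟩
  · rw [he, hv, zero_smul, zero_add, QuadraticMap.map_add C₁.form, QuadraticMap.map_add C₁.form]
    simp only [QuadraticMap.map_smul, polar_add_left, polar_smul_left, polar_smul_right, hab₁, hac,
      hbc, ha₁, hb₁, hQc, smul_eq_mul]
    ring
  · rw [he, hv, zero_smul, add_zero, add_assoc, QuadraticMap.map_add C₂.form,
      QuadraticMap.map_add C₂.form]
    simp only [QuadraticMap.map_smul, polar_add_right, polar_smul_left, polar_smul_right, hab₂,
      polar_comm _ d, had, hbd, hQd, smul_eq_mul]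
    ring

end EdgeSurface

/-! ### The form of degree eight and divisibility by it. -/

namespace EdgeSurface

open MvPolynomial

/-- The equation of the edge surface of two conics in the coordinates of `exists_normal_form`. -/
noncomputable def edgePoly (α β : ℂ) : MvPolynomial (Fin 4) ℂ :=
  edgeDisc (C α) (C β) (X 1 ^ 2) (X 2 ^ 2) (X 3 ^ 2) (X 0 ^ 2)

theorem eval_edgePoly (α β : ℂ) (v : Vec) :
    eval v (edgePoly α β) = edgeDisc α β (v 1 ^ 2) (v 2 ^ 2) (v 3 ^ 2) (v 0 ^ 2) := by
  simp [edgePoly, map_edgeDisc]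

/-- The discriminant has degree four in the coefficients of the cubic, which are quadratic forms
here. -/
theorem isHomogeneous_edgePoly (α β : ℂ) : (edgePoly α β).IsHomogeneous 8 := by
  have hX (i : Fin 4) : (X i ^ 2 : MvPolynomial (Fin 4) ℂ).IsHomogeneous 2 :=
    isHomogeneous_X_pow i 2
  have key {a b c d : MvPolynomial (Fin 4) ℂ} (ha : a.IsHomogeneous 2) (hb : b.IsHomogeneous 2)
      (hc : c.IsHomogeneous 2) (hd : d.IsHomogeneous 2) :
      (Cubic.discr ⟨a, b, c, d⟩).IsHomogeneous 8 := by
    have h4 : (4 : MvPolynomial (Fin 4) ℂ) = C 4 := (map_ofNat C 4).symm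
    have h27 : (27 : MvPolynomial (Fin 4) ℂ) = C 27 := (map_ofNat C 27).symm
    have h18 : (18 : MvPolynomial (Fin 4) ℂ) = C 18 := (map_ofNat C 18).symm
    simp only [Cubic.discr, h4, h27, h18]
    exact ((((((hb.pow 2).mul (hc.pow 2)).sub ((ha.C_mul 4).mul (hc.pow 3))).sub
      (((hb.pow 3).C_mul 4).mul hd)).sub (((ha.pow 2).C_mul 27).mul (hd.pow 2))).add
      ((((ha.C_mul 18).mul hb).mul hc).mul hd))
  refine key (hX 3) ?_ ?_ ?_
  · rw [← C_add]
    exact ((((hX 0).add ((hX 3).C_mul _)).add ((hX 1).C_mul _)).add ((hX 2).C_mul _))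
  · rw [← C_add, ← C_mul]
    exact ((hX 0).C_mul _).add ((((hX 3).add (hX 1)).add (hX 2)).C_mul _)
  · rw [← C_mul]
    exact (hX 0).C_mul _

/-- Up to a constant, `edgePoly` is monic of degree eight in its first variable. -/
theorem exists_monic_finSuccEquiv_edgePoly {α β : ℂ} (hαβ : α ≠ β) :
    ∃ m : Polynomial (MvPolynomial (Fin 3) ℂ), m.Monic ∧ m.natDegree = 8 ∧
      finSuccEquiv ℂ 3 (edgePoly α β) = Polynomial.C (C ((α - β) ^ 2)) * m := by
  obtain ⟨e₀, e₁, e₂, e₃, he⟩ := exists_edgeDisc_expansion (C α : MvPolynomial (Fin 3) ℂ) (C β)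
    (X 0 ^ 2) (X 1 ^ 2) (X 2 ^ 2)
  have hk : (C ((α - β) ^ 2) * C ((α - β) ^ 2)⁻¹ : MvPolynomial (Fin 3) ℂ) = 1 := by
    rw [← C_mul, mul_inv_cancel₀ (pow_ne_zero 2 (sub_ne_zero.2 hαβ)), C_1]
  let p : Polynomial (MvPolynomial (Fin 3) ℂ) := Polynomial.C (C ((α - β) ^ 2)⁻¹) *
    (Polynomial.C e₃ * Polynomial.X ^ 6 + Polynomial.C e₂ * Polynomial.X ^ 4
      + Polynomial.C e₁ * Polynomial.X ^ 2 + Polynomial.C e₀)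
  have hp : p.natDegree ≤ 6 := by
    simp only [p]
    compute_degree
  have hp' : p.degree < (8 : ℕ) :=
    (Polynomial.degree_le_natDegree.trans (WithBot.coe_le_coe.2 hp)).trans_lt
      (WithBot.coe_lt_coe.2 (by norm_num))
  refine ⟨Polynomial.X ^ 8 + p, Polynomial.monic_X_pow_add hp',
    by rw [Polynomial.natDegree_add_eq_left_of_degree_lt (by rwa [Polynomial.degree_X_pow]),
      Polynomial.natDegree_X_pow], ?_⟩
  have h := he (Polynomial.C : MvPolynomial (Fin 3) ℂ →+* _) (Polynomial.X ^ 2)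
  have hX (j : Fin 3) : finSuccEquiv ℂ 3 (X j.succ) = Polynomial.C (X j) := finSuccEquiv_X_succ
  have hC (r : ℂ) : finSuccEquiv ℂ 3 (C r) = Polynomial.C (C r) := by
    simp [finSuccEquiv_apply]
  have hF : finSuccEquiv ℂ 3 (edgePoly α β) = edgeDisc (Polynomial.C (C α)) (Polynomial.C (C β))
      (Polynomial.C (X 0 ^ 2)) (Polynomial.C (X 1 ^ 2)) (Polynomial.C (X 2 ^ 2))
      (Polynomial.X ^ 2) := by
    have := map_edgeDisc (RingHomClass.toRingHom (finSuccEquiv ℂ 3)) (C α) (C β)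
      (X 1 ^ 2) (X 2 ^ 2) (X 3 ^ 2) (X 0 ^ 2)
    refine this.trans ?_
    simp only [map_pow, RingHom.coe_coe, hC, finSuccEquiv_X_zero]
    rw [show (1 : Fin 4) = Fin.succ 0 from rfl, show (2 : Fin 4) = Fin.succ 1 from rfl,
      show (3 : Fin 4) = Fin.succ 2 from rfl, hX, hX, hX]
  have hk' := congrArg (Polynomial.C (R := MvPolynomial (Fin 3) ℂ)) hk
  rw [Polynomial.C_mul, Polynomial.C_1] at hk'
  have hk'' : (C ((α - β) ^ 2) : MvPolynomial (Fin 3) ℂ) = (C α - C β) ^ 2 := by simp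
  rw [hF, h, ← hk'']
  simp only [p]
  linear_combination (-(Polynomial.C e₃ * Polynomial.X ^ 6 + Polynomial.C e₂ * Polynomial.X ^ 4
      + Polynomial.C e₁ * Polynomial.X ^ 2 + Polynomial.C e₀)) * hk'

theorem edgePoly_ne_zero {α β : ℂ} (hαβ : α ≠ β) : edgePoly α β ≠ 0 := by
  obtain ⟨m, hm, -, h⟩ := exists_monic_finSuccEquiv_edgePoly hαβ
  intro h0
  rw [h0, map_zero, eq_comm, mul_eq_zero, Polynomial.C_eq_zero, C_eq_zero] at h
  exact h.elim (pow_ne_zero 2 (sub_ne_zero.2 hαβ)) hm.ne_zero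

/-- A polynomial that vanishes at all parametrised points is divisible by `edgePoly`. -/
theorem edgePoly_dvd {α β : ℂ} (hα : α ≠ 0) (hβ : β ≠ 0) (hαβ : α ≠ β)
    {G : MvPolynomial (Fin 4) ℂ}
    (hG : ∀ s t ρ z w : ℂ, s ≠ 0 → z ≠ 0 → w ≠ 0 → z ^ 2 = -(α ^ 2 * s ^ 2 + β ^ 2 * t ^ 2) →
      w ^ 2 = -(ρ ^ 2 * (α * s ^ 2 + β * t ^ 2)) →
      eval ![w, s * (α + ρ), t * (β + ρ), z] G = 0) :
    edgePoly α β ∣ G := by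
  obtain ⟨m, hm, hdeg, hmF⟩ := exists_monic_finSuccEquiv_edgePoly hαβ
  have hc : α - β ≠ 0 := sub_ne_zero.2 hαβ
  let D₂ : MvPolynomial (Fin 3) ℂ := (C (α + β) * X 2 ^ 2 + C α * X 0 ^ 2 + C β * X 1 ^ 2) ^ 2
    - C (4 * α * β) * X 2 ^ 2 * (X 0 ^ 2 + X 1 ^ 2 + X 2 ^ 2)
  let D₃ : MvPolynomial (Fin 3) ℂ :=
    (C (α ^ 2) * X 0 ^ 2 + C (β ^ 2) * X 1 ^ 2 + C ((α - β) ^ 2) * X 2 ^ 2) ^ 3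
      - C (27 * (α - β) ^ 2 * α ^ 2 * β ^ 2) * X 0 ^ 2 * X 1 ^ 2 * X 2 ^ 2
  -- The product of the genericity conditions of `exists_eight_param`.
  let D : MvPolynomial (Fin 3) ℂ :=
    X 0 * X 1 * X 2 * ((X 0 ^ 2 + X 1 ^ 2 + X 2 ^ 2) * D₂ * D₃)
  have hD : D ≠ 0 := by
    refine mul_ne_zero (mul_ne_zero (mul_ne_zero (X_ne_zero 0) (X_ne_zero 1)) (X_ne_zero 2)) ?_
    intro h
    -- At this point `D₂ = (α - β)^2` and `D₃ = (α - β)^6`.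
    have h' := congrArg (eval ![0, 0, 1]) h
    simp only [D₂, D₃, map_mul, map_add, map_sub, map_pow, eval_C, eval_X, map_zero,
      Matrix.cons_val_zero, Matrix.cons_val_one, Matrix.cons_val] at h'
    refine pow_ne_zero 8 hc ?_
    linear_combination h'
  let r := finSuccEquiv ℂ 3 G %ₘ m
  have hrdeg : r.natDegree < 8 := by
    rw [← hdeg]
    exact Polynomial.natDegree_modByMonic_lt _ hm (by
      rintro rfl
      simp at hdeg)
  have hr (a : Fin 3 → ℂ) (ha : eval a D ≠ 0) : r.map (eval a) = 0 := by
    simp only [D, D₂, D₃, map_mul, map_add, map_sub, map_pow, eval_C, eval_X, mul_ne_zero_iff]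
      at ha
    obtain ⟨⟨⟨h0, h1⟩, h2⟩, ⟨k1, k2⟩, k3⟩ := ha
    obtain ⟨S, hS, hpar⟩ := exists_eight_param hα hβ hαβ h0 h1 h2 k1 k2 k3
    refine Polynomial.eq_zero_of_natDegree_lt_card_of_eval_eq_zero' _ S (fun w hw => ?_)
      (hS ▸ Polynomial.natDegree_map_le.trans_lt hrdeg)
    obtain ⟨hw0, s, t, ρ, hx, hy, hz, hw2⟩ := hpar w hw
    have hs : s ≠ 0 := by
      rintro rfl
      simp [hx] at h0
    have hpt : (Fin.cons w a : Fin 4 → ℂ) = ![w, s * (α + ρ), t * (β + ρ), a 2] := by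
      rw [← hx, ← hy]
      ext i
      fin_cases i <;> rfl
    have hGw : Polynomial.eval w ((finSuccEquiv ℂ 3 G).map (eval a)) = 0 := by
      rw [← eval_eq_eval_mv_eval', hpt]
      exact hG s t ρ (a 2) w hs h2 hw0 hz hw2
    have hFw : Polynomial.eval w ((finSuccEquiv ℂ 3 (edgePoly α β)).map (eval a)) = 0 := by
      rw [← eval_eq_eval_mv_eval', hpt, eval_edgePoly]
      have h := edgeDisc_eq_zero_of_param α β s t 1 ρ
      simpa [hz, hw2] using h
    rw [hmF, Polynomial.map_mul, Polynomial.eval_mul, Polynomial.map_C, Polynomial.eval_C, eval_C,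
      mul_eq_zero] at hFw
    have hmw := hFw.resolve_left (pow_ne_zero 2 hc)
    have hdiv := congrArg (fun p => Polynomial.eval w (p.map (eval a)))
      (Polynomial.modByMonic_add_div (finSuccEquiv ℂ 3 G) m)
    simpa [hGw, hmw] using hdiv
  have hr0 : r = 0 := by
    ext1 i
    -- Each coefficient of the remainder vanishes wherever `D` does not, so its product with `D`
    -- vanishes everywhere.
    have h : r.coeff i * D = 0 := by
      refine MvPolynomial.funext fun a => ?_
      rw [map_mul, map_zero, mul_eq_zero, or_iff_not_imp_right]
      intro ha
      simpa using congrArg (Polynomial.coeff · i) (hr a ha)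
    simpa using (mul_eq_zero.1 h).resolve_right hD
  have hmG : m ∣ finSuccEquiv ℂ 3 G := (Polynomial.modByMonic_eq_zero_iff_dvd hm).1 hr0
  rw [← map_dvd_iff (finSuccEquiv ℂ 3), hmF]
  refine (IsUnit.mul_left_dvd ?_).2 hmG
  exact ((isUnit_iff_ne_zero.2 (pow_ne_zero 2 hc)).map C).map Polynomial.C

end EdgeSurface

/-! ### Zariski closure, coordinate changes and points of bisecants. -/

namespace EdgeSurface

open MvPolynomial QuadraticMap

/-- The union of the stationary bisecants of two conics. -/
def bisecantUnion (C₁ C₂ : SmoothConic) : Set P3 :=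
  {x | ∃ L : Submodule ℂ Vec, IsStationaryBisecant C₁ C₂ L ∧ x.submodule ≤ L}

theorem subset_zariskiClosure (S : Set P3) : S ⊆ zariskiClosure S :=
  fun _ hx _ _ _ h => h _ hx

theorem zariskiClosure_idem (S : Set P3) : zariskiClosure (zariskiClosure S) = zariskiClosure S :=
  Set.Subset.antisymm (fun _ hx n F hF h => hx n F hF fun _ hy => hy n F hF h)
    (subset_zariskiClosure _)

theorem eval_smul_of_isHomogeneous {F : MvPolynomial (Fin 4) ℂ} {n : ℕ} (hF : F.IsHomogeneous n)
    (c : ℂ) (v : Vec) : eval (c • v) F = c ^ n * eval v F := by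
  rw [eval_eq, eval_eq, Finset.mul_sum]
  refine Finset.sum_congr rfl fun d hd => ?_
  simp only [Pi.smul_apply, smul_eq_mul, mul_pow, Finset.prod_mul_distrib,
    Finset.prod_pow_eq_pow_sum]
  rw [← hF.degree_eq_sum_deg_support hd]
  ring

theorem eval_rep_mk_eq_zero_iff {F : MvPolynomial (Fin 4) ℂ} {n : ℕ} (hF : F.IsHomogeneous n)
    {v : Vec} (hv : v ≠ 0) : eval (Projectivization.mk ℂ v hv).rep F = 0 ↔ eval v F = 0 := by
  obtain ⟨a, ha⟩ := Projectivization.exists_smul_eq_mk_rep ℂ v hv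
  rw [← ha, Units.smul_def, eval_smul_of_isHomogeneous hF, mul_eq_zero]
  simp

/-- The ideal of the closure of `S` is principal if a homogeneous polynomial that vanishes on `S`
divides all polynomials that vanish on `S`. -/
theorem isSurfaceOfDegree_zariskiClosure {S : Set P3} {F : MvPolynomial (Fin 4) ℂ} {d : ℕ}
    (hF0 : F ≠ 0) (hF : F.IsHomogeneous d) (hFS : ∀ x ∈ S, eval x.rep F = 0)
    (hdvd : ∀ G : MvPolynomial (Fin 4) ℂ, (∀ v ∈ coneOver S, eval v G = 0) → F ∣ G) :
    IsSurfaceOfDegree (zariskiClosure S) d := by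
  refine ⟨zariskiClosure_idem S, F, hF0, hF, le_antisymm (fun G hG => ?_) ?_⟩
  · refine Ideal.mem_span_singleton.2 (hdvd G fun v hv => ?_)
    obtain ⟨hv0, hvS⟩ := hv
    exact hG v ⟨hv0, subset_zariskiClosure S hvS⟩
  · rw [Ideal.span_singleton_le_iff_mem]
    rintro v ⟨hv0, hv⟩
    exact (eval_rep_mk_eq_zero_iff hF hv0).1 (hv d F hF hFS)

/-- Pull-back of a polynomial by a linear change of coordinates. -/
noncomputable def pullback (e : Vec →ₗ[ℂ] Vec) :
    MvPolynomial (Fin 4) ℂ →ₐ[ℂ] MvPolynomial (Fin 4) ℂ :=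
  aeval fun i => ∑ j, C (e (Pi.single j 1) i) * X j

theorem eval_pullback (e : Vec →ₗ[ℂ] Vec) (F : MvPolynomial (Fin 4) ℂ) (v : Vec) :
    eval v (pullback e F) = eval (e v) F := by
  have hv : e v = fun i => ∑ j, e (Pi.single j 1) i * v j := by
    have hsingle (j : Fin 4) : (fun k => if j = k then 1 else 0 : Vec) = Pi.single j 1 := by
      ext k
      simp [Pi.single_apply, eq_comm]
    ext i
    rw [LinearMap.pi_apply_eq_sum_univ e v]
    simp only [Finset.sum_apply, Pi.smul_apply, smul_eq_mul, hsingle, mul_comm]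
  have hid : (eval v).comp (algebraMap ℂ (MvPolynomial (Fin 4) ℂ)) = RingHom.id ℂ := by
    ext c
    simp [algebraMap_eq]
  rw [hv, pullback, map_aeval, hid]
  simp only [map_sum, map_mul, eval_C, eval_X]
  rfl

theorem isHomogeneous_pullback (e : Vec →ₗ[ℂ] Vec) {F : MvPolynomial (Fin 4) ℂ} {n : ℕ}
    (hF : F.IsHomogeneous n) : (pullback e F).IsHomogeneous n := by
  have h := hF.aeval (fun i => ∑ j, C (e (Pi.single j 1) i) * X j)
    (fun i => IsHomogeneous.sum _ _ 1 fun j _ => isHomogeneous_C_mul_X _ j)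
  rwa [one_mul] at h

theorem pullback_symm_pullback (e : Vec ≃ₗ[ℂ] Vec) (F : MvPolynomial (Fin 4) ℂ) :
    pullback e.symm.toLinearMap (pullback e.toLinearMap F) = F :=
  MvPolynomial.funext fun v => by simp [eval_pullback]

theorem rep_mem_submodule (p : P3) : p.rep ∈ p.submodule := by
  rw [Projectivization.submodule_eq]
  exact Submodule.mem_span_singleton_self _

theorem exists_of_mem_bisecantUnion {C₁ C₂ : SmoothConic} {x : P3} (hx : x ∈ bisecantUnion C₁ C₂) :
    ∃ p q r : Vec, p ≠ 0 ∧ r ≠ 0 ∧ p ∈ C₁.plane ∧ q ∈ C₂.plane ∧ r ∈ C₁.plane ∧ r ∈ C₂.plane ∧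
      C₁.form p = 0 ∧ C₂.form q = 0 ∧ polar C₁.form p r = 0 ∧ polar C₂.form q r = 0 ∧
      ∃ u v : ℂ, x.rep = u • p + v • q := by
  obtain ⟨L, ⟨p, hp, q, hq, -, ⟨r, hr₁, hr₂⟩, rfl⟩, hxL⟩ := hx
  obtain ⟨h₁, h₁'⟩ := hr₁ (rep_mem_submodule r)
  obtain ⟨h₂, h₂'⟩ := hr₂ (rep_mem_submodule r)
  have hxm := hxL (rep_mem_submodule x)
  rw [Submodule.mem_sup] at hxm
  obtain ⟨a, ha, b, hb, hab⟩ := hxm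
  rw [Projectivization.submodule_eq, Submodule.mem_span_singleton] at ha hb
  obtain ⟨u, rfl⟩ := ha
  obtain ⟨v, rfl⟩ := hb
  exact ⟨p.rep, q.rep, r.rep, p.rep_nonzero, r.rep_nonzero, hp.1 (rep_mem_submodule p),
    hq.1 (rep_mem_submodule q), h₁, h₂, hp.2, hq.2, by simpa using h₁', by simpa using h₂', u, v,
    hab.symm⟩

/-- Taking `p` off the second plane gives at once that `p` and `q` are distinct points and that `p +
q ≠ 0`. -/
theorem add_mem_coneOver {C₁ C₂ : SmoothConic} {p q r : Vec} (hp : p ∈ C₁.plane)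
    (hp' : p ∉ C₂.plane) (hq : q ∈ C₂.plane) (hq0 : q ≠ 0) (hr0 : r ≠ 0) (hr₁ : r ∈ C₁.plane)
    (hr₂ : r ∈ C₂.plane) (hfp : C₁.form p = 0) (hfq : C₂.form q = 0)
    (hpr : polar C₁.form p r = 0) (hqr : polar C₂.form q r = 0) :
    p + q ∈ coneOver (bisecantUnion C₁ C₂) := by
  have hp0 : p ≠ 0 := by
    rintro rfl
    exact hp' C₂.plane.zero_mem
  have hpq0 : p + q ≠ 0 := by
    intro h
    rw [add_eq_zero_iff_eq_neg] at h
    exact hp' (h ▸ C₂.plane.neg_mem hq)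
  refine ⟨hpq0, _, ⟨.mk ℂ p hp0, (SmoothConic.mk_mem_points hp0).2 ⟨hp, hfp⟩, .mk ℂ q hq0,
    (SmoothConic.mk_mem_points hq0).2 ⟨hq, hfq⟩, ?_, ⟨.mk ℂ r hr0, ?_, ?_⟩, rfl⟩, ?_⟩
  · rw [Ne, Projectivization.mk_eq_mk_iff']
    rintro ⟨a, rfl⟩
    exact hp' (C₂.plane.smul_mem a hq)
  · rw [Projectivization.submodule_mk, Submodule.span_singleton_le_iff_mem]
    exact (SmoothConic.mem_tangentLine_mk hp0).2 ⟨hr₁, hpr⟩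
  · rw [Projectivization.submodule_mk, Submodule.span_singleton_le_iff_mem]
    exact (SmoothConic.mem_tangentLine_mk hq0).2 ⟨hr₂, hqr⟩
  · rw [Projectivization.submodule_mk, Submodule.span_singleton_le_iff_mem]
    simp only [Projectivization.submodule_mk]
    exact Submodule.add_mem_sup (Submodule.mem_span_singleton_self p)
      (Submodule.mem_span_singleton_self q)

/-- The points of stationary bisecants in the coordinates of `exists_normal_form`. -/
theorem edgeDisc_eq_zero_of_bisecant {α β : ℂ} (hα : α ≠ 0) (hβ : β ≠ 0) {p q r : Vec}
    (hp0 : p ≠ 0) (hr0 : r ≠ 0) (hp : p 0 = 0) (hq : q 3 = 0) (hr₀ : r 0 = 0) (hr₃ : r 3 = 0)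
    (hfp : p 1 ^ 2 + p 2 ^ 2 + p 3 ^ 2 = 0) (hfq : α * q 1 ^ 2 + β * q 2 ^ 2 + q 0 ^ 2 = 0)
    (hpr : p 1 * r 1 + p 2 * r 2 = 0) (hqr : α * q 1 * r 1 + β * q 2 * r 2 = 0) (u v : ℂ) :
    eval (u • p + v • q) (edgePoly α β) = 0 := by
  -- The meeting point `r` is a nontrivial solution of two linear equations, so their determinant
  -- vanishes.
  have hdep : α * q 1 * p 2 = β * q 2 * p 1 := by
    by_cases h1 : r 1 = 0
    · have h2 : r 2 ≠ 0 := fun h2 => hr0 (by ext i; fin_cases i <;> assumption)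
      apply mul_left_cancel₀ h2
      linear_combination α * q 1 * hpr - p 1 * hqr
    · apply mul_left_cancel₀ h1
      linear_combination p 2 * hqr - β * q 2 * hpr
  have hexists : ∃ ρ : ℂ, α * q 1 = ρ * p 1 ∧ β * q 2 = ρ * p 2 := by
    by_cases h1 : p 1 = 0
    · have h2 : p 2 ≠ 0 := fun h2 => hp0 (by
        have h3 : p 3 = 0 := by simpa [h1, h2] using hfp
        ext i
        fin_cases i <;> assumption)
      refine ⟨β * q 2 / p 2, ?_, by field_simp⟩
      field_simp
      linear_combination hdep
    · refine ⟨α * q 1 / p 1, by field_simp, ?_⟩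
      field_simp
      linear_combination -hdep
  obtain ⟨ρ, h1, h2⟩ := hexists
  obtain ⟨s, hs⟩ : ∃ s, p 1 = α * s := ⟨p 1 / α, by field_simp⟩
  obtain ⟨t, ht⟩ : ∃ t, p 2 = β * t := ⟨p 2 / β, by field_simp⟩
  have hq1 : q 1 = ρ * s := by
    apply mul_left_cancel₀ hα
    rw [h1, hs]
    ring
  have hq2 : q 2 = ρ * t := by
    apply mul_left_cancel₀ hβ
    rw [h2, ht]
    ring
  have h := edgeDisc_eq_zero_of_param α β s t u (v * ρ)
  rw [eval_edgePoly]
  simp only [Pi.add_apply, Pi.smul_apply, smul_eq_mul, hp, hq, hq1, hq2, hs, ht] at hfp hfq ⊢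
  refine Eq.trans ?_ h
  congr 1
  · ring
  · ring
  · linear_combination u ^ 2 * hfp
  · linear_combination v ^ 2 * hfq

end EdgeSurface

/-! ### Transport from the diagonal coordinates. -/

theorem mainTheorem3 (C₁ C₂ : EdgeSurface.SmoothConic)
    (hplanes : C₁.plane ≠ C₂.plane)
    (hdisjoint : Disjoint C₁.points C₂.points)
    (htangent₁ : ¬ C₁.IsTangentTo C₂.plane)
    (htangent₂ : ¬ C₂.IsTangentTo C₁.plane) :
    EdgeSurface.IsSurfaceOfDegree (EdgeSurface.edgeSurface C₁ C₂) 8 := by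
  open EdgeSurface MvPolynomial QuadraticMap in
  obtain ⟨e, α, β, hα, hβ, hαβ, hP₁, hP₂, hQ₁, hQ₂⟩ :=
    exists_normal_form hplanes hdisjoint htangent₁ htangent₂
  have hpol₁ (v w : Vec) (hv : v 0 = 0) (hw : w 0 = 0) :
      polar C₁.form (e v) (e w) = 2 * (v 1 * w 1 + v 2 * w 2 + v 3 * w 3) := by
    rw [polar, ← map_add, hQ₁ _ (by simp [hv, hw]), hQ₁ v hv, hQ₁ w hw]
    simp only [Pi.add_apply]
    ring
  have hpol₂ (v w : Vec) (hv : v 3 = 0) (hw : w 3 = 0) :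
      polar C₂.form (e v) (e w) = 2 * (α * v 1 * w 1 + β * v 2 * w 2 + v 0 * w 0) := by
    rw [polar, ← map_add, hQ₂ _ (by simp [hv, hw]), hQ₂ v hv, hQ₂ w hw]
    simp only [Pi.add_apply]
    ring
  have hpull : pullback e.toLinearMap (pullback e.symm.toLinearMap (edgePoly α β))
      = edgePoly α β := pullback_symm_pullback e.symm _
  refine isSurfaceOfDegree_zariskiClosure (F := pullback e.symm.toLinearMap (edgePoly α β))
    (fun h => edgePoly_ne_zero hαβ ?_) (isHomogeneous_pullback _ (isHomogeneous_edgePoly α β))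
    (fun x hx => ?_) fun G hG => ?_
  · rw [← hpull, h, map_zero]
  · obtain ⟨p, q, r, hp0, hr0, hp, hq, hr₁, hr₂, hfp, hfq, hpr, hqr, u, v, hx⟩ :=
      exists_of_mem_bisecantUnion hx
    obtain ⟨p, rfl⟩ := e.surjective p
    obtain ⟨q, rfl⟩ := e.surjective q
    obtain ⟨r, rfl⟩ := e.surjective r
    rw [hP₁] at hp hr₁
    rw [hP₂] at hq hr₂
    rw [hQ₁ p hp] at hfp
    rw [hQ₂ q hq] at hfq
    rw [hpol₁ p r hp hr₁, hr₂, mul_zero, add_zero] at hpr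
    rw [hpol₂ q r hq hr₂, hr₁, mul_zero, add_zero] at hqr
    rw [eval_pullback, hx, ← map_smul, ← map_smul, ← map_add, LinearEquiv.coe_coe,
      LinearEquiv.symm_apply_apply]
    exact edgeDisc_eq_zero_of_bisecant hα hβ (by simpa using hp0) (by simpa using hr0) hp hq hr₁
      hr₂ hfp hfq (by simpa using hpr) (by simpa using hqr) u v
  · suffices h : edgePoly α β ∣ pullback e.toLinearMap G by
      rw [← pullback_symm_pullback e G]
      exact map_dvd _ h
    refine edgePoly_dvd hα hβ hαβ fun s t ρ z w hs hz hw hz2 hw2 => ?_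
    rw [eval_pullback]
    apply hG
    have hsum : ![w, s * (α + ρ), t * (β + ρ), z]
        = ![0, α * s, β * t, z] + ![w, ρ * s, ρ * t, 0] := by
      ext i
      fin_cases i <;> simp <;> ring
    rw [hsum, LinearEquiv.coe_coe, map_add]
    -- This `r` is where both tangents meet the common line of the planes; `s ≠ 0` keeps it nonzero.
    refine add_mem_coneOver (r := e ![0, -(β * t), α * s, 0]) ((hP₁ _).2 (by simp))
      (fun h => hz ((hP₂ _).1 h)) ((hP₂ _).2 (by simp)) (fun h => hw ?_) (fun h => ?_)
      ((hP₁ _).2 (by simp)) ((hP₂ _).2 (by simp)) ?_ ?_ ?_ ?_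
    · exact congrFun (e.map_eq_zero_iff.1 h) 0
    · have := congrFun (e.map_eq_zero_iff.1 h) 2
      simp [hα, hs] at this
    · rw [hQ₁ _ (by simp)]
      simp
      linear_combination hz2
    · rw [hQ₂ _ (by simp)]
      simp
      linear_combination hw2
    · rw [hpol₁ _ _ (by simp) (by simp)]
      simp
      ring
    · rw [hpol₂ _ _ (by simp) (by simp)]
      simp
      ring
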